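/- Let $R$ be a commutative ring with identity having exactly $n$ maximal ideals, where $3\le n<\infty$. Let $\Gamma_2'(R)$ be the reduced comaximal graph of $R$: its vertices are the non-units of $R$ that do not lie in the Jacobson radical $J(R)$, and two distinct vertices $x,y$ are adjacent if and only if $Rx+Ry=R$. In a connected graph $G$, a vertex $w$ strongly resolves two vertices $u,v$ if some shortest path from $u$ to $w$ contains $v$ or some shortest path from $v$ to $w$ contains $u$; a set $W$ of vertices is a strong resolving set if every two distinct vertices of $G$ are strongly resolved by some member of $W$; and the strong metric dimension $\operatorname{sdim}_M(G)$ is the smallest cardinality of a strong resolving set. Then $\Gamma_2'(R)$ is connected and $$\operatorname{sdim}_M(\Gamma_2'(R)) = |V(\Gamma_2'(R))| - 2n + 2,$$ understood as the equality of cardinals $\operatorname{sdim}_M(\Gamma_2'(R)) + 2n = |V(\Gamma_2'(R))| + 2$ (so that $\operatorname{sdim}_M(\Gamma_2'(R)) = |V(\Gamma_2'(R))|$ when the vertex set is infinite). -/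

import Mathlib

namespace SimpleGraph

variable {V : Type*}

/-- `w` strongly resolves `u` and `v` in `G`: some shortest walk (a walk whose length is the graph
distance, which is automatically a path) from `u` to `w` contains `v`, or some shortest walk from
`v` to `w` contains `u`. -/
def StronglyResolves (G : SimpleGraph V) (w u v : V) : Prop :=
  (∃ p : G.Walk u w, p.length = G.dist u w ∧ v ∈ p.support) ∨
    (∃ p : G.Walk v w, p.length = G.dist v w ∧ u ∈ p.support)

/-- `W` is a strong resolving set of `G`: every pair of distinct vertices is strongly resolved
by a member of `W`. -/
def IsStrongResolvingSet (G : SimpleGraph V) (W : Set V) : Prop :=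
  ∀ u v : V, u ≠ v → ∃ w ∈ W, G.StronglyResolves w u v

/-- The strong metric dimension of a connected graph: the smallest cardinality of a strong
resolving set. -/
noncomputable def strongMetricDim (G : SimpleGraph V) : Cardinal :=
  sInf {c : Cardinal | ∃ W : Set V, G.IsStrongResolvingSet W ∧ Cardinal.mk W = c}

end SimpleGraph

/-- The comaximal graph `Γ₀(R)`: the vertices are the elements of `R`, and distinct `x`, `y` are
adjacent iff `Rx + Ry = R`. -/
def comaximalGraph (R : Type*) [CommRing R] : SimpleGraph R where
  Adj x y := x ≠ y ∧ Ideal.span {x} ⊔ Ideal.span {y} = ⊤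
  symm := ⟨fun _ _ h => ⟨h.1.symm, by rw [sup_comm]; exact h.2⟩⟩
  loopless := ⟨fun _ h => h.1 rfl⟩

/-- The non-units of `R` outside the Jacobson radical `J(R)` (the intersection of all maximal
ideals). -/
def comaximalVertices (R : Type*) [CommRing R] : Set R :=
  {x | ¬ IsUnit x ∧ x ∉ (⊥ : Ideal R).jacobson}

/-- The reduced comaximal graph `Γ₂'(R)`: the subgraph of `Γ₀(R)` induced on the non-units
outside `J(R)`. -/
def reducedComaximalGraph (R : Type*) [CommRing R] : SimpleGraph (comaximalVertices R) :=
  (comaximalGraph R).induce (comaximalVertices R)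

/-! Label each vertex `x` by the set `D x` of maximal ideals containing it. Labels are nonempty and
proper, adjacency is disjointness, and by the Chinese remainder theorem every nonempty proper subset
is a label. For distinct vertices the distance is 1 if the labels are disjoint, 3 if they meet and
cover everything, 2 otherwise. These distances show that `W` is strongly resolving iff the vertices
outside `W` have distinct labels that are pairwise disjoint or nested
(`disjoint_or_ssubset_of_notMem`, `isStrongResolvingSet_compl`). So the complement of an optimal `W`
is a transversal of a largest laminar family of nonempty proper subsets of an `n`-set. Such a family
has `2n - 2` members. As the complement is finite, the count also holds for infinite cardinals. -/

/-! ### Maximum size of laminar families. -/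

namespace Finset

variable {ι : Type*}

/-- A family of finite sets is laminar if any two members are disjoint or nested. -/
def IsLaminar (F : Finset (Finset ι)) : Prop :=
  ∀ s ∈ F, ∀ t ∈ F, Disjoint s t ∨ s ⊆ t ∨ t ⊆ s

/-- A laminar family of nonempty subsets of a nonempty finite set `A` has at most `2 |A| - 1`
members. -/
theorem IsLaminar.card_add_one_le [DecidableEq ι] {A : Finset ι} (hA : A.Nonempty)
    {F : Finset (Finset ι)} (hF : F.IsLaminar) (hne : ∀ s ∈ F, s.Nonempty)
    (hsub : ∀ s ∈ F, s ⊆ A) : F.card + 1 ≤ 2 * A.card := by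
  induction hA using Finset.Nonempty.cons_induction generalizing F with
  | singleton a =>
    have : F ⊆ {{a}} := fun s hs => by
      rw [mem_singleton]
      exact (hne s hs).subset_singleton_iff.1 (hsub s hs)
    have := card_le_card this
    simp at this ⊢
    omega
  | cons a A ha hA ih =>
    -- Delete `a` from every member. At most one pair of members merges, and at most one member,
    -- `{a}`, becomes empty, so at most two members are lost.
    set F₀ := F.filter (a ∉ ·) with hF₀
    set F₁ := (F.filter (a ∈ ·)).image (·.erase a) with hF₁
    have mem₀ : ∀ {s}, s ∈ F₀ ↔ s ∈ F ∧ a ∉ s := by simp [hF₀]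
    have mem₁ : ∀ {s}, s ∈ F₁ → insert a s ∈ F ∧ a ∉ s := by
      intro s hs
      obtain ⟨t, ht, rfl⟩ := mem_image.1 hs
      rw [mem_filter] at ht
      exact ⟨by rw [insert_erase ht.2]; exact ht.1, notMem_erase a t⟩
    have card₁ : F₁.card = (F.filter (a ∈ ·)).card := by
      refine card_image_of_injOn fun s hs t ht h => ?_
      have hs := (mem_filter.1 hs).2
      have ht := (mem_filter.1 ht).2
      rw [← insert_erase hs, ← insert_erase ht]
      exact congrArg (insert a) h
    have card_add : (F.filter (a ∈ ·)).card + F₀.card = F.card :=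
      card_filter_add_card_filter_not _
    have inter : (F₁ ∩ F₀).card ≤ 1 := by
      -- `t` meets `insert a s` but omits `a`, so laminarity leaves only `t ⊆ insert a s`, hence `t
      -- ⊆ s`.
      have key : ∀ s ∈ F₁ ∩ F₀, ∀ t ∈ F₁ ∩ F₀, s ⊆ t → s = t := by
        intro s hs t ht hst
        rw [mem_inter] at hs ht
        obtain ⟨hs1, has⟩ := mem₁ hs.1
        have ht0 := (mem₀.1 ht.2)
        obtain ⟨x, hx⟩ := hne s (mem₀.1 hs.2).1
        rcases hF _ hs1 _ ht0.1 with h | h | h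
        · exact absurd (hst hx) (disjoint_left.1 h (mem_insert_of_mem hx))
        · exact absurd (h (mem_insert_self a s)) ht0.2
        · refine hst.antisymm fun y hy => ?_
          rcases mem_insert.1 (h hy) with rfl | h
          · exact absurd hy ht0.2
          · exact h
      refine card_le_one.2 fun s hs t ht => ?_
      have hs' := mem_inter.1 hs
      have ht' := mem_inter.1 ht
      have has := (mem₁ hs'.1)
      have hat := (mem₁ ht'.1)
      rcases hF _ has.1 _ hat.1 with h | h | h
      · exact absurd (mem_insert_self a t) (disjoint_left.1 h (mem_insert_self a s))
      · exact key s hs t ht ((insert_subset_insert_iff has.2).1 h)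
      · exact (key t ht s hs ((insert_subset_insert_iff hat.2).1 h)).symm
    have lift : ∀ s ∈ (F₁ ∪ F₀).erase ∅, ∃ t ∈ F, s = t.erase a := by
      intro s hs
      rcases mem_union.1 (mem_of_mem_erase hs) with h | h
      · exact ⟨_, (mem₁ h).1, (erase_insert (mem₁ h).2).symm⟩
      · exact ⟨s, (mem₀.1 h).1, (erase_eq_of_notMem (mem₀.1 h).2).symm⟩
    have hlam : ((F₁ ∪ F₀).erase ∅).IsLaminar := by
      intro s' hs' t' ht'
      obtain ⟨s, hs, rfl⟩ := lift s' hs'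
      obtain ⟨t, ht, rfl⟩ := lift t' ht'
      rcases hF s hs t ht with h | h | h
      · exact .inl (h.mono (erase_subset _ _) (erase_subset _ _))
      · exact .inr (.inl (erase_subset_erase a h))
      · exact .inr (.inr (erase_subset_erase a h))
    have := ih hlam (fun s hs => nonempty_iff_ne_empty.2 (mem_erase.1 hs).1) (by
      intro s hs
      obtain ⟨t, ht, rfl⟩ := lift s hs
      intro x hx
      rw [mem_erase] at hx
      exact (mem_cons.1 (hsub t ht hx.2)).resolve_left hx.1)
    have h1 := card_union_add_card_inter F₁ F₀
    have h2 := pred_card_le_card_erase (s := F₁ ∪ F₀) (a := ∅)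
    rw [card_cons]
    omega

/-- A nonempty finite set `A` has a laminar family of `2 |A| - 1` nonempty subsets, one of
which is `A`. -/
theorem exists_isLaminar_card_add_one_eq [DecidableEq ι] {A : Finset ι} (hA : A.Nonempty) :
    ∃ F : Finset (Finset ι), F.IsLaminar ∧ (∀ s ∈ F, s.Nonempty) ∧ (∀ s ∈ F, s ⊆ A) ∧
      A ∈ F ∧ F.card + 1 = 2 * A.card := by
  induction hA using Finset.Nonempty.cons_induction with
  | singleton a => exact ⟨{{a}}, by simp [IsLaminar], by simp, by simp, by simp, by simp⟩
  | cons a A ha hA ih =>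
    obtain ⟨F, hF, hne, hsub, -, hcard⟩ := ih
    have hbig : cons a A ha ∉ F := fun h => ha (hsub _ h (mem_cons_self a A))
    have hsing : {a} ∉ insert (cons a A ha) F := by
      rw [mem_insert, not_or]
      constructor
      · intro h
        have := congrArg card h
        rw [card_singleton, card_cons] at this
        have := hA.card_pos
        omega
      · exact fun h => ha (hsub _ h (mem_singleton_self a))
    have hsub' : ∀ s ∈ insert {a} (insert (cons a A ha) F), s ⊆ cons a A ha := by
      intro s hs
      simp only [mem_insert] at hs
      rcases hs with rfl | rfl | hs
      · simp
      · exact Subset.rfl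
      · exact (hsub s hs).trans (subset_cons ha)
    -- Each new point adds two sets: its singleton and the whole enlarged set.
    refine ⟨insert {a} (insert (cons a A ha) F), ?_, ?_, hsub', by simp, ?_⟩
    · have hdisj : ∀ s ∈ F, Disjoint {a} s := fun s hs =>
        disjoint_singleton_left.2 fun h => ha (hsub s hs h)
      intro s hs t ht
      have hs' := hsub' s hs
      have ht' := hsub' t ht
      simp only [mem_insert] at hs ht
      rcases hs with rfl | rfl | hs
      · rcases ht with rfl | rfl | ht
        · exact .inr (.inl Subset.rfl)
        · exact .inr (.inl hs')
        · exact .inl (hdisj t ht)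
      · exact .inr (.inr ht')
      · rcases ht with rfl | rfl | ht
        · exact .inl (hdisj s hs).symm
        · exact .inr (.inl hs')
        · exact hF s hs t ht
    · intro s hs
      simp only [mem_insert] at hs
      rcases hs with rfl | rfl | hs
      · simp
      · exact cons_nonempty ha
      · exact hne s hs
    · rw [card_insert_of_notMem hsing, card_insert_of_notMem hbig, card_cons]
      omega

end Finset

/-! ### Strong resolution as equality in the triangle inequality. -/

namespace SimpleGraph

variable {V ι : Type*} {G : SimpleGraph V}

theorem Connected.stronglyResolves_of_dist {u v w : V} (hG : G.Connected)
    (h : G.dist u v + G.dist v w ≤ G.dist u w) : G.StronglyResolves w u v := by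
  obtain ⟨p, hp⟩ := hG.exists_walk_length_eq_dist u v
  obtain ⟨q, hq⟩ := hG.exists_walk_length_eq_dist v w
  refine .inl ⟨p.append q, ?_, ?_⟩
  · have := hG.dist_triangle (u := u) (v := v) (w := w)
    rw [Walk.length_append]
    omega
  · rw [Walk.mem_support_append_iff]
    exact .inl p.end_mem_support

theorem StronglyResolves.symm {u v w : V} (h : G.StronglyResolves w u v) :
    G.StronglyResolves w v u :=
  Or.symm h

theorem dist_add_dist_le_of_mem_support {u v w : V} {p : G.Walk u w}
    (hp : p.length = G.dist u w) (hv : v ∈ p.support) :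
    G.dist u v + G.dist v w ≤ G.dist u w := by
  classical
  have h := congrArg Walk.length (p.take_spec hv)
  rw [Walk.length_append, hp] at h
  rw [← h]
  exact add_le_add (dist_le _) (dist_le _)

/-! ### Distances in a blow-up of the disjointness graph. -/

/-- `D` presents `G` as a blow-up of the disjointness graph on the nonempty proper subsets
of `ι`. -/
structure IsDisjointnessBlowup [Fintype ι] (G : SimpleGraph V) (D : V → Finset ι) : Prop where
  adj_iff : ∀ u v, G.Adj u v ↔ Disjoint (D u) (D v)
  nonempty : ∀ v, (D v).Nonempty
  ne_univ : ∀ v, D v ≠ Finset.univ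
  exists_eq : ∀ s : Finset ι, s.Nonempty → s ≠ Finset.univ → ∃ v, D v = s

namespace IsDisjointnessBlowup

variable [Fintype ι] {D : V → Finset ι}

theorem two_le_dist (h : G.IsDisjointnessBlowup D) (hG : G.Connected) {u v : V} (hne : u ≠ v)
    (huv : ¬ Disjoint (D u) (D v)) : 2 ≤ G.dist u v :=
  hG.one_lt_dist_of_ne_of_not_adj hne fun e => huv ((h.adj_iff _ _).1 e)

theorem dist_eq_one (h : G.IsDisjointnessBlowup D) {u v : V} (huv : Disjoint (D u) (D v)) :
    G.dist u v = 1 :=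
  dist_eq_one_iff_adj.2 ((h.adj_iff _ _).2 huv)

variable [DecidableEq ι]

theorem exists_compl (h : G.IsDisjointnessBlowup D) (u : V) : ∃ v, D v = (D u)ᶜ :=
  h.exists_eq _ (Finset.nonempty_iff_ne_empty.2 fun e => h.ne_univ u (by simpa using e))
    fun e => (h.nonempty u).ne_empty (by simpa using e)

theorem exists_common_neighbor (h : G.IsDisjointnessBlowup D) {u v : V}
    (huv : D u ∪ D v ≠ Finset.univ) : ∃ w, G.Adj u w ∧ G.Adj w v := by
  obtain ⟨w, hw⟩ := h.exists_eq (D u ∪ D v)ᶜ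
    (Finset.nonempty_iff_ne_empty.2 fun e => huv (Finset.compl_eq_empty_iff _ |>.1 e))
    fun e => (h.nonempty u).ne_empty
      (Finset.union_eq_empty.1 (Finset.compl_eq_univ_iff _ |>.1 e)).1
  refine ⟨w, (h.adj_iff _ _).2 ?_, (h.adj_iff _ _).2 ?_⟩ <;> rw [hw]
  · exact disjoint_compl_right.mono_left Finset.subset_union_left
  · exact (disjoint_compl_right.mono_left Finset.subset_union_right).symm

/-- If the labels cover everything, their complements are disjoint and give the two inner vertices
of a walk of length 3. -/
theorem exists_walk_length_le (h : G.IsDisjointnessBlowup D) (u v : V) :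
    ∃ p : G.Walk u v, p.length ≤ 3 := by
  by_cases huv : D u ∪ D v = Finset.univ
  · obtain ⟨u', hu⟩ := h.exists_compl u
    obtain ⟨v', hv⟩ := h.exists_compl v
    have h1 : G.Adj u u' := (h.adj_iff _ _).2 (hu ▸ disjoint_compl_right)
    have h2 : G.Adj u' v' := (h.adj_iff _ _).2 (by
      rw [hu, hv, Finset.disjoint_iff_inter_eq_empty, ← Finset.compl_union, huv,
        Finset.compl_univ])
    have h3 : G.Adj v' v := (h.adj_iff _ _).2 (hv ▸ disjoint_compl_left)
    exact ⟨.cons h1 (.cons h2 (.cons h3 .nil)), le_rfl⟩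
  · obtain ⟨w, h1, h2⟩ := h.exists_common_neighbor huv
    exact ⟨.cons h1 (.cons h2 .nil), by simp⟩

theorem dist_le_three (h : G.IsDisjointnessBlowup D) (u v : V) : G.dist u v ≤ 3 :=
  let ⟨p, hp⟩ := h.exists_walk_length_le u v
  (dist_le p).trans hp

theorem dist_le_two (h : G.IsDisjointnessBlowup D) {u v : V}
    (huv : D u ∪ D v ≠ Finset.univ) : G.dist u v ≤ 2 :=
  let ⟨_, h1, h2⟩ := h.exists_common_neighbor huv
  dist_le (.cons h1 (.cons h2 .nil))

theorem connected [Nontrivial ι] (h : G.IsDisjointnessBlowup D) : G.Connected := by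
  obtain ⟨a, b, hab⟩ := exists_pair_ne ι
  obtain ⟨v, -⟩ := h.exists_eq {a} (by simp) fun e => hab <| by
    simpa using (Finset.mem_singleton.1 (e ▸ Finset.mem_univ b)).symm
  have : Nonempty V := ⟨v⟩
  exact ⟨fun u w => ⟨(h.exists_walk_length_le u w).choose⟩⟩

theorem three_le_dist (h : G.IsDisjointnessBlowup D) (hG : G.Connected) {u v : V}
    (huv : ¬ Disjoint (D u) (D v)) (hun : D u ∪ D v = Finset.univ) : 3 ≤ G.dist u v := by
  have hne : u ≠ v := by
    rintro rfl
    exact h.ne_univ u (by simpa using hun)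
  have h2 := h.two_le_dist hG hne huv
  by_contra h3
  obtain ⟨p, hp⟩ := hG.exists_walk_length_eq_dist u v
  have hp2 : p.length = 2 := by omega
  match p, hp2 with
  | .cons (v := w) ha (.cons hb .nil), _ =>
    -- The label of a middle vertex would avoid both labels, hence be empty.
    obtain ⟨x, hx⟩ := h.nonempty w
    have := hun ▸ Finset.mem_univ x
    rcases Finset.mem_union.1 this with hx' | hx'
    · exact Finset.disjoint_left.1 ((h.adj_iff _ _).1 ha) hx' hx
    · exact Finset.disjoint_left.1 ((h.adj_iff _ _).1 hb) hx hx'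

/-! ### Necessity: labels outside a strong resolving set. -/

/-- Since distances are at most 3, the only possible split is 3 = 2 + 1. So `D w` covers the
complement of `D u` and avoids `D v`. -/
theorem ssubset_of_dist (h : G.IsDisjointnessBlowup D) (hG : G.Connected) {u v w : V}
    (huv : u ≠ v) (hvw : v ≠ w) (hint : ¬ Disjoint (D u) (D v))
    (hd : G.dist u v + G.dist v w ≤ G.dist u w) : D v ⊂ D u := by
  have h1 := h.two_le_dist hG huv hint
  have h2 := hG.pos_dist_of_ne hvw
  have h3 := h.dist_le_three u w
  have hun : D u ∪ D w = Finset.univ := by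
    by_contra e
    have := h.dist_le_two e
    omega
  have hdisj : Disjoint (D v) (D w) :=
    (h.adj_iff _ _).1 (dist_eq_one_iff_adj.1 (by omega))
  refine Finset.ssubset_iff_subset_ne.2 ⟨fun x hx => ?_, fun e => ?_⟩
  · exact (Finset.mem_union.1 (hun ▸ Finset.mem_univ x)).resolve_right
      (Finset.disjoint_left.1 hdisj hx)
  · have := h.dist_eq_one (e ▸ hdisj)
    omega

/-- Two vertices outside a strong resolving set have disjoint or strictly nested labels. -/
theorem disjoint_or_ssubset_of_notMem (h : G.IsDisjointnessBlowup D) (hG : G.Connected)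
    {W : Set V} (hW : G.IsStrongResolvingSet W) {u v : V} (huv : u ≠ v) (hu : u ∉ W)
    (hv : v ∉ W) : Disjoint (D u) (D v) ∨ D u ⊂ D v ∨ D v ⊂ D u := by
  by_cases hint : Disjoint (D u) (D v)
  · exact .inl hint
  obtain ⟨w, hw, ⟨p, hp, hmem⟩ | ⟨p, hp, hmem⟩⟩ := hW u v huv
  · exact .inr (.inr (h.ssubset_of_dist hG huv (ne_of_mem_of_not_mem hw hv).symm hint
      (dist_add_dist_le_of_mem_support hp hmem)))
  · exact .inr (.inl (h.ssubset_of_dist hG huv.symm (ne_of_mem_of_not_mem hw hu).symm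
      (fun e => hint e.symm) (dist_add_dist_le_of_mem_support hp hmem)))

/-! ### Sufficiency: laminar transversals. -/

section Sufficient

variable {S : Set V}

/-- The vertex labelled `(D v)ᶜ` is adjacent to `v` and at distance 3 from `u`. Its label crosses `D
u`, so it lies outside `S`. -/
theorem exists_resolves_of_ssubset (h : G.IsDisjointnessBlowup D) (hG : G.Connected)
    (hS : ∀ u ∈ S, ∀ v ∈ S, Disjoint (D u) (D v) ∨ D u ⊆ D v ∨ D v ⊆ D u)
    {u v : V} (hu : u ∈ S) (hvu : D v ⊂ D u) : ∃ w ∈ Sᶜ, G.StronglyResolves w u v := by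
  obtain ⟨w, hw⟩ := h.exists_compl v
  obtain ⟨x, hxu, hxv⟩ := Finset.exists_of_ssubset hvu
  obtain ⟨y, hy⟩ := h.nonempty v
  have hint : ¬ Disjoint (D u) (D w) := fun e =>
    Finset.disjoint_left.1 e hxu (by simpa [hw] using hxv)
  have hun : D u ∪ D w = Finset.univ := by
    ext z
    have := @hvu.1 z
    by_cases hz : z ∈ D v <;> simp [hw, hz, this]
  refine ⟨w, fun hwS => ?_, hG.stronglyResolves_of_dist ?_⟩
  · rcases hS u hu w hwS with e | e | e
    · exact hint e
    · have := e (hvu.1 hy)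
      simp [hw, hy] at this
    · exact h.ne_univ u (by rwa [Finset.union_eq_left.2 e] at hun)
  · have h1 := h.three_le_dist hG hint hun
    have h2 : G.dist u v ≤ 2 := h.dist_le_two (by
      rw [Finset.union_eq_left.2 hvu.1]
      exact h.ne_univ u)
    have h3 : G.dist v w = 1 := h.dist_eq_one (hw ▸ disjoint_compl_right)
    omega

theorem exists_resolves_of_one_lt_card (h : G.IsDisjointnessBlowup D) (hG : G.Connected)
    (hS : ∀ u ∈ S, ∀ v ∈ S, Disjoint (D u) (D v) ∨ D u ⊆ D v ∨ D v ⊆ D u)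
    {u v : V} (hu : u ∈ S) (huv : Disjoint (D u) (D v)) (hc : 1 < (D u).card) :
    ∃ w ∈ Sᶜ, G.StronglyResolves w u v := by
  obtain ⟨a, ha, b, hb, hab⟩ := Finset.one_lt_card.1 hc
  obtain ⟨y, hy⟩ := h.nonempty v
  have hyu : y ∉ D u := Finset.disjoint_right.1 huv hy
  -- This label covers the rest and meets `D u` in `a`, giving distance 3 from `u`. It misses `b`,
  -- so it crosses `D u`, and `b` lies outside its union with `D v`.
  obtain ⟨w, hw⟩ := h.exists_eq (insert a (D u)ᶜ) (Finset.insert_nonempty _ _) fun e => by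
    have := e ▸ Finset.mem_univ b
    simp [hb, hab.symm] at this
  have hbw : b ∉ D w := by simp [hw, hb, hab.symm]
  have haw : a ∈ D w := by simp [hw]
  have hyw : y ∈ D w := by simp [hw, hyu]
  have hint : ¬ Disjoint (D u) (D w) := fun e => Finset.disjoint_left.1 e ha haw
  have hun : D u ∪ D w = Finset.univ := by
    ext z
    simp [hw]
  refine ⟨w, fun hwS => ?_, hG.stronglyResolves_of_dist ?_⟩
  · rcases hS u hu w hwS with e | e | e
    · exact hint e
    · exact hbw (e hb)
    · exact hyu (e hyw)
  · have h1 := h.three_le_dist hG hint hun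
    have h2 : G.dist v w ≤ 2 := h.dist_le_two fun e => by
      rcases Finset.mem_union.1 (e ▸ Finset.mem_univ b) with e | e
      · exact Finset.disjoint_left.1 huv hb e
      · exact hbw e
    have h3 : G.dist u v = 1 := h.dist_eq_one huv
    omega

theorem stronglyResolves_of_pair (h : G.IsDisjointnessBlowup D) (hG : G.Connected)
    {u v w : V} {a b c : ι} (hu : D u = {a}) (hv : D v = {b}) (hw : D w = {a, c})
    (hab : a ≠ b) (hac : a ≠ c) (hbc : b ≠ c) : G.StronglyResolves w u v := by
  refine hG.stronglyResolves_of_dist ?_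
  have h1 : G.dist u v = 1 := h.dist_eq_one (by simp [hu, hv, hab])
  have h2 : G.dist v w = 1 := h.dist_eq_one (by simp [hv, hw, hab.symm, hbc])
  have h3 := h.two_le_dist hG (u := u) (v := w) (by
    rintro rfl
    have : c ∈ ({a} : Finset ι) := by rw [← hu, hw]; simp
    exact hac (Finset.mem_singleton.1 this).symm) (by simp [hu, hw])
  omega

theorem exists_resolves_of_disjoint (h : G.IsDisjointnessBlowup D) (hG : G.Connected)
    (hι : 3 ≤ Fintype.card ι)
    (hS : ∀ u ∈ S, ∀ v ∈ S, Disjoint (D u) (D v) ∨ D u ⊆ D v ∨ D v ⊆ D u)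
    {u v : V} (hu : u ∈ S) (hv : v ∈ S) (huv : Disjoint (D u) (D v)) :
    ∃ w ∈ Sᶜ, G.StronglyResolves w u v := by
  by_cases hcu : 1 < (D u).card
  · exact h.exists_resolves_of_one_lt_card hG hS hu huv hcu
  by_cases hcv : 1 < (D v).card
  · obtain ⟨w, hw, hr⟩ := h.exists_resolves_of_one_lt_card hG hS hv huv.symm hcv
    exact ⟨w, hw, hr.symm⟩
  have hpu := (h.nonempty u).card_pos
  have hpv := (h.nonempty v).card_pos
  obtain ⟨a, ha⟩ := Finset.card_eq_one.1 (show (D u).card = 1 by omega)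
  obtain ⟨b, hb⟩ := Finset.card_eq_one.1 (show (D v).card = 1 by omega)
  have hab : a ≠ b := by
    rintro rfl
    simp [ha, hb] at huv
  have hpair : ∀ x y : ι, ({x, y} : Finset ι) ≠ Finset.univ := fun x y e => by
    have h1 := congrArg Finset.card e
    have h2 := Finset.card_le_two (a := x) (b := y)
    rw [Finset.card_univ] at h1
    omega
  obtain ⟨c, hc⟩ : ∃ c, c ∉ ({a, b} : Finset ι) := by
    by_contra! e
    exact hpair a b (Finset.eq_univ_iff_forall.2 e)
  rw [Finset.mem_insert, Finset.mem_singleton, not_or] at hc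
  -- For two singletons, `{a}`, `{b}`, `{a, c}` is a geodesic, and likewise with `a` and `b`
  -- swapped. The labels `{a, c}` and `{b, c}` cross, so `w` or `z` lies outside `S`.
  obtain ⟨w, hw⟩ := h.exists_eq {a, c} (by simp) (hpair a c)
  obtain ⟨z, hz⟩ := h.exists_eq {b, c} (by simp) (hpair b c)
  by_cases hwS : w ∈ S
  · refine ⟨z, fun hzS => ?_, (h.stronglyResolves_of_pair hG hb ha hz hab.symm
      (Ne.symm hc.2) (Ne.symm hc.1)).symm⟩
    rcases hS w hwS z hzS with e | e | e
    · exact Finset.disjoint_left.1 e (show c ∈ D w by simp [hw]) (by simp [hz])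
    · have := @e a (by simp [hw])
      simp [hz, hab, Ne.symm hc.1] at this
    · have := @e b (by simp [hz])
      simp [hw, hab.symm, Ne.symm hc.2] at this
  · exact ⟨w, hwS, h.stronglyResolves_of_pair hG ha hb hw hab (Ne.symm hc.1) (Ne.symm hc.2)⟩

/-- The complement of a set of vertices whose labels are distinct and pairwise disjoint or nested
is a strong resolving set. -/
theorem isStrongResolvingSet_compl (h : G.IsDisjointnessBlowup D) (hG : G.Connected)
    (hι : 3 ≤ Fintype.card ι) (hinj : Set.InjOn D S)
    (hS : ∀ u ∈ S, ∀ v ∈ S, Disjoint (D u) (D v) ∨ D u ⊆ D v ∨ D v ⊆ D u) :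
    G.IsStrongResolvingSet Sᶜ := by
  intro u v huv
  by_cases hu : u ∈ S
  · by_cases hv : v ∈ S
    · have hD : D u ≠ D v := fun e => huv (hinj hu hv e)
      rcases hS u hu v hv with e | e | e
      · exact h.exists_resolves_of_disjoint hG hι hS hu hv e
      · obtain ⟨w, hw, hr⟩ := h.exists_resolves_of_ssubset hG hS hv
          (Finset.ssubset_iff_subset_ne.2 ⟨e, hD⟩)
        exact ⟨w, hw, hr.symm⟩
      · exact h.exists_resolves_of_ssubset hG hS hu
          (Finset.ssubset_iff_subset_ne.2 ⟨e, hD.symm⟩)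
    · exact ⟨v, hv, hG.stronglyResolves_of_dist (by simp)⟩
  · exact ⟨u, hu, (hG.stronglyResolves_of_dist (by simp)).symm⟩

end Sufficient

/-! ### Counting and the strong metric dimension. -/

/-- Adjoining the whole set keeps a family laminar, so excluding it costs one in the bound `2n - 1`.
-/
theorem card_add_two_le [Nonempty ι] {F : Finset (Finset ι)} (hF : F.IsLaminar)
    (hne : ∀ s ∈ F, s.Nonempty) (hun : ∀ s ∈ F, s ≠ Finset.univ) :
    F.card + 2 ≤ 2 * Fintype.card ι := by
  have := Finset.IsLaminar.card_add_one_le (F := insert Finset.univ F)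
    (Finset.univ_nonempty (α := ι)) (by
      intro s hs t ht
      rw [Finset.mem_insert] at hs ht
      rcases hs with rfl | hs
      · exact .inr (.inr (Finset.subset_univ _))
      rcases ht with rfl | ht
      · exact .inr (.inl (Finset.subset_univ _))
      exact hF s hs t ht) (by
      intro s hs
      rcases Finset.mem_insert.1 hs with rfl | hs
      · exact Finset.univ_nonempty
      · exact hne s hs) (fun _ _ => Finset.subset_univ _)
  rw [Finset.card_insert_of_notMem fun e => hun _ e rfl, Finset.card_univ] at this
  omega

theorem mk_add_two_le (h : G.IsDisjointnessBlowup D) (hG : G.Connected) [Nonempty ι]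
    {W : Set V} (hW : G.IsStrongResolvingSet W) :
    Cardinal.mk V + 2 ≤ Cardinal.mk W + 2 * (Fintype.card ι : Cardinal) := by
  have key : ∀ u ∈ Wᶜ, ∀ v ∈ Wᶜ, u ≠ v →
      Disjoint (D u) (D v) ∨ D u ⊂ D v ∨ D v ⊂ D u := fun u hu v hv huv =>
    h.disjoint_or_ssubset_of_notMem hG hW huv hu hv
  have hinj : Set.InjOn D Wᶜ := by
    intro u hu v hv e
    by_contra huv
    rcases key u hu v hv huv with e' | e' | e'
    · rw [e, disjoint_self] at e'
      exact (h.nonempty v).ne_empty e'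
    · exact e'.ne e
    · exact e'.ne e.symm
  -- There are finitely many labels, so `V` splits into `W` and a finite set, and no cardinal
  -- subtraction is needed.
  have hfin : (Wᶜ : Set V).Finite := Set.Finite.of_finite_image (Set.toFinite _) hinj
  obtain ⟨S, hS⟩ := hfin.exists_finset_coe
  have hcard : (S.image D).card = S.card :=
    Finset.card_image_of_injOn (by rw [hS]; exact hinj)
  have hmem : ∀ {u}, u ∈ S ↔ u ∈ Wᶜ := fun {u} => by rw [← hS, Finset.mem_coe]
  have hle := card_add_two_le (F := S.image D) (by
      intro s hs t ht
      obtain ⟨u, hu, rfl⟩ := Finset.mem_image.1 hs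
      obtain ⟨v, hv, rfl⟩ := Finset.mem_image.1 ht
      by_cases huv : u = v
      · exact .inr (.inl (huv ▸ Finset.Subset.rfl))
      · exact (key u (hmem.1 hu) v (hmem.1 hv) huv).imp_right
          (Or.imp (fun e => e.subset) (fun e => e.subset)))
    (by
      intro s hs
      obtain ⟨u, -, rfl⟩ := Finset.mem_image.1 hs
      exact h.nonempty u)
    (by
      intro s hs
      obtain ⟨u, -, rfl⟩ := Finset.mem_image.1 hs
      exact h.ne_univ u)
  rw [hcard] at hle
  rw [← Cardinal.mk_sum_compl W, ← hS, Finset.coe_sort_coe, Cardinal.mk_coe_finset, add_assoc]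
  gcongr
  exact_mod_cast hle

theorem exists_isStrongResolvingSet (h : G.IsDisjointnessBlowup D) (hG : G.Connected)
    (hι : 3 ≤ Fintype.card ι) :
    ∃ W : Set V, G.IsStrongResolvingSet W ∧
      Cardinal.mk W + 2 * (Fintype.card ι : Cardinal) = Cardinal.mk V + 2 := by
  have : Nonempty ι := Fintype.card_pos_iff.1 (by omega)
  obtain ⟨F, hF, hne, -, hun, hcard⟩ :=
    Finset.exists_isLaminar_card_add_one_eq (Finset.univ_nonempty (α := ι))
  have := hG.nonempty
  -- One vertex is kept out of `W` for each proper member of an extremal laminar family.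
  choose! g hg using fun s (hs : s ∈ F.erase Finset.univ) =>
    h.exists_eq s (hne s (Finset.mem_of_mem_erase hs)) (Finset.ne_of_mem_erase hs)
  classical
  set S := (F.erase Finset.univ).image g
  have hS : ∀ u ∈ S, D u ∈ F ∧ g (D u) = u := by
    intro u hu
    obtain ⟨s, hs, rfl⟩ := Finset.mem_image.1 hu
    rw [hg s hs]
    exact ⟨Finset.mem_of_mem_erase hs, rfl⟩
  have hScard : S.card + 2 = 2 * Fintype.card ι := by
    rw [Finset.card_image_of_injOn fun s hs t ht e => by
      rw [← hg s hs, ← hg t ht]; exact congrArg D e, Finset.card_erase_of_mem hun]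
    rw [Finset.card_univ] at hcard
    omega
  refine ⟨(S : Set V)ᶜ, h.isStrongResolvingSet_compl hG hι ?_ ?_, ?_⟩
  · intro u hu v hv e
    rw [← (hS u hu).2, ← (hS v hv).2, e]
  · exact fun u hu v hv => hF _ (hS u hu).1 _ (hS v hv).1
  · rw [← Cardinal.mk_sum_compl (S : Set V), Finset.coe_sort_coe, Cardinal.mk_coe_finset]
    have : (S.card : Cardinal) + 2 = 2 * (Fintype.card ι : Cardinal) := by exact_mod_cast hScard
    rw [← this]
    ring

theorem strongMetricDim_add (h : G.IsDisjointnessBlowup D) (hG : G.Connected)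
    (hι : 3 ≤ Fintype.card ι) :
    G.strongMetricDim + 2 * (Fintype.card ι : Cardinal) = Cardinal.mk V + 2 := by
  have : Nonempty ι := Fintype.card_pos_iff.1 (by omega)
  obtain ⟨W, hW, hWcard⟩ := h.exists_isStrongResolvingSet hG hι
  apply le_antisymm
  · rw [← hWcard]
    gcongr
    exact csInf_le' ⟨W, hW, rfl⟩
  · obtain ⟨W', hW', e⟩ := csInf_mem (s := {c : Cardinal | ∃ W : Set V,
      G.IsStrongResolvingSet W ∧ Cardinal.mk W = c}) ⟨_, W, hW, rfl⟩
    rw [strongMetricDim, ← e]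
    exact h.mk_add_two_le hG hW'

end IsDisjointnessBlowup

end SimpleGraph

/-! ### The comaximal graph as a disjointness blow-up. -/

section Comaximal

variable {R : Type*} [CommRing R]

theorem span_singleton_sup_eq_top_iff_forall_maximalSpectrum (x y : R) :
    Ideal.span {x} ⊔ Ideal.span {y} = ⊤ ↔
      ∀ m : MaximalSpectrum R, x ∈ m.asIdeal → y ∉ m.asIdeal := by
  constructor
  · intro h m hx hy
    refine m.isMaximal.ne_top (top_le_iff.1 (h ▸ sup_le ?_ ?_)) <;>
      rwa [Ideal.span_singleton_le_iff_mem]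
  · intro h
    by_contra hne
    obtain ⟨m, hm, hle⟩ := Ideal.exists_le_maximal _ hne
    exact h ⟨m, hm⟩ ((Ideal.span_singleton_le_iff_mem _).1 (le_sup_left.trans hle))
      ((Ideal.span_singleton_le_iff_mem _).1 (le_sup_right.trans hle))

theorem mem_comaximalVertices_iff (x : R) :
    x ∈ comaximalVertices R ↔ (∃ m : MaximalSpectrum R, x ∈ m.asIdeal) ∧
      ∃ m : MaximalSpectrum R, x ∉ m.asIdeal := by
  refine and_congr ⟨fun h => ?_, ?_⟩ (not_iff_comm.1 ?_)
  · obtain ⟨m, hm, hx⟩ := exists_max_ideal_of_mem_nonunits h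
    exact ⟨⟨m, hm⟩, hx⟩
  · rintro ⟨m, hx⟩ hu
    exact m.isMaximal.ne_top (Ideal.eq_top_of_isUnit_mem _ hx hu)
  · push Not
    rw [Ideal.jacobson, Ideal.mem_sInf]
    exact ⟨fun h I hI => h ⟨I, hI.2⟩, fun h m => h ⟨bot_le, m.isMaximal⟩⟩

open Classical in
theorem reducedComaximalGraph_isDisjointnessBlowup [Fintype (MaximalSpectrum R)] :
    (reducedComaximalGraph R).IsDisjointnessBlowup
      fun x => Finset.univ.filter fun m : MaximalSpectrum R => (x : R) ∈ m.asIdeal := by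
  refine ⟨fun u v => ?_, fun v => ?_, fun v => ?_, fun s hs hs' => ?_⟩
  · have hu := ((mem_comaximalVertices_iff _).1 u.2).1
    have key := span_singleton_sup_eq_top_iff_forall_maximalSpectrum (u : R) v
    simp only [Finset.disjoint_left, Finset.mem_filter, Finset.mem_univ, true_and]
    rw [← key]
    refine ⟨fun h => h.2, fun h => ⟨fun e => ?_, h⟩⟩
    obtain ⟨m, hm⟩ := hu
    have e' : (u : R) = v := e
    exact key.1 h m hm (e' ▸ hm)
  · obtain ⟨m, hm⟩ := ((mem_comaximalVertices_iff _).1 v.2).1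
    exact ⟨m, by simpa using hm⟩
  · obtain ⟨m, hm⟩ := ((mem_comaximalVertices_iff _).1 v.2).2
    intro e
    have := e ▸ Finset.mem_univ m
    exact hm (by simpa using this)
  · have hcop : Pairwise (Function.onFun IsCoprime
        fun m : MaximalSpectrum R => m.asIdeal) := fun m m' hne =>
      haveI := m.isMaximal
      haveI := m'.isMaximal
      Ideal.isCoprime_of_isMaximal fun e => hne (MaximalSpectrum.ext e)
    -- Chinese remainder: residue 0 exactly at the ideals of `s`, and 1 elsewhere, realises the
    -- label `s`.
    obtain ⟨r, hr⟩ := Ideal.exists_forall_sub_mem_ideal hcop fun m => if m ∈ s then 0 else 1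
    have hmem : ∀ m : MaximalSpectrum R, r ∈ m.asIdeal ↔ m ∈ s := by
      intro m
      have := hr m
      by_cases hm : m ∈ s
      · simpa [hm] using this
      · simp only [hm, if_false, iff_false] at this ⊢
        intro h
        exact m.isMaximal.ne_top
          ((Ideal.eq_top_iff_one _).2 (by simpa using sub_mem h this))
    refine ⟨⟨r, (mem_comaximalVertices_iff r).2 ⟨?_, ?_⟩⟩, ?_⟩
    · exact hs.imp fun m hm => (hmem m).2 hm
    · by_contra! h
      exact hs' (Finset.eq_univ_iff_forall.2 fun m => (hmem m).1 (h m))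
    · ext m
      simp [hmem]

end Comaximal

theorem mainTheorem4 {R : Type*} [CommRing R] (n : ℕ) (hn : 3 ≤ n)
    (hR : Nat.card (MaximalSpectrum R) = n) :
    (reducedComaximalGraph R).Connected ∧
      (reducedComaximalGraph R).strongMetricDim + 2 * (n : Cardinal) =
        Cardinal.mk (comaximalVertices R) + 2 := by
  classical
  have : Finite (MaximalSpectrum R) := Nat.finite_of_card_ne_zero (by omega)
  let := Fintype.ofFinite (MaximalSpectrum R)
  rw [Nat.card_eq_fintype_card] at hR
  subst hR
  have h := reducedComaximalGraph_isDisjointnessBlowup (R := R)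
  have : Nontrivial (MaximalSpectrum R) := Fintype.one_lt_card_iff_nontrivial.1 (by omega)
  exact ⟨h.connected, h.strongMetricDim_add h.connected hn⟩
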